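/- Conventions. A polytope $P$ is the convex hull of a nonempty finite set of points in a finite-dimensional real vector space; $\mathcal F(P)$ is the set of its nonempty faces ($P$ included), $\mathrm{vert}(F)$ is the vertex set of a face $F$, and a $d$-polytope is one of dimension $d$. A triangulation of $P$ is a finite geometric simplicial complex with underlying set $P$. Pointed triangulations. Let $\mathcal C_P$ be a triangulation of $P$, and for $F\in\mathcal F(P)$ let $\mathcal C_F$ be the set of simplices of $\mathcal C_P$ contained in $F$. Given a family $V(P)=(\mathbf v_F)_{F\in\mathcal F(P)}$ of apexes $\mathbf v_F\in \mathrm{vert}(F)$, $\mathcal C_P$ is the $V(P)$-pointed triangulation if (1) for every $k$ and every $k$-face $F$, $\mathcal C_F$ is a triangulation of $F$ in which every simplex is a face of a $k$-simplex, and $\mathbf v_F$ lies in every $k$-simplex of $\mathcal C_F$; (2) for any faces $F_1,F_2$, if $\mathbf v_{F_1},\mathbf v_{F_2}\in F_1\cap F_2$ then $\mathbf v_{F_1}=\mathbf v_{F_2}$; (3) for every face $F$ and every $\mathbf w\in \mathrm{vert}(F)\setminus\{\mathbf v_F\}$ the edge $\mathrm{conv}\{\mathbf v_F,\mathbf w\}$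 is in $\mathcal C_F$. Polytope numbers. For apexes $V(P)$ satisfying (2), the $V(P)$-polytope numbers $P(n)$ and interior polytope numbers $P(n)^\sharp$ ($n\ge 0$) are defined by induction on $\dim P$ and $n$, each face $F$ of $P$ carrying the apexes of its own faces. If $\dim P=0$, then $P(0)=P(0)^\sharp=0$ and $P(n)=P(n)^\sharp=1$ for $n\ge1$. If $\dim P\ge 1$, then $P(0)=0$, $P(1)=1$, $P(0)^\sharp=P(1)^\sharp=0$, and for $n\ge2$ $$P(n)=P(n-1)+\sum_{F\in\mathcal F(P),\ \mathbf v_P\notin F}F(n)^\sharp,\qquad P(n)^\sharp=P(n)-\sum_{F\in\mathcal F(P)\setminus\{P\}}F(n)^\sharp .$$ For $k\ge 0$ let $\alpha^k(n)$ denote the polytope numbers of a $k$-simplex (any $k$-simplex and any apexes satisfying (2) may be used), and set $\alpha^k(m)=0$ for $m<0$. Theorem (Decomposition theorem 4). Let $P$ be a $d$-polytope with the $V(P)$-pointed triangulation $\mathcal C_P$, let $P(n)$ be the $V(P)$-polytope numbers, and for $0\le k\le d$ let $d_k$ be the number of $k$-simplices in $\mathcal C_P$. Then for every integer $n\ge 0$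 with $n\ne 1$, $$P(n)=\sum_{k=0}^{d}d_k\,\alpha^k\bigl(n-(k+1)\bigr).$$ -/

import Mathlib

namespace Polytope

noncomputable section

variable {E : Type*} [NormedAddCommGroup E] [NormedSpace ℝ E]

/-- A nonempty (convex) polytope: the convex hull of a nonempty finite set of points. -/
def IsPolytope (P : Set E) : Prop :=
  ∃ s : Finset E, s.Nonempty ∧ P = convexHull ℝ (s : Set E)

/-- The dimension of (the affine hull of) a nonempty set. -/
def dim (P : Set E) : ℕ := Module.finrank ℝ (vectorSpan ℝ P)

/-- The nonempty faces of `P`, the face `P` itself included: the sets of points of `P` at which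
a linear functional attains its maximum over `P`. -/
def faces (P : Set E) : Set (Set E) := {F | F.Nonempty ∧ IsExposed ℝ P F}

/-- The nonempty faces of `P` other than `P`. -/
def properFaces (P : Set E) : Set (Set E) := {F | F ∈ faces P ∧ F ≠ P}

theorem dim_lt_of_mem_properFaces [FiniteDimensional ℝ E] {P F : Set E}
    (hF : F ∈ properFaces P) : dim F < dim P := by
  obtain ⟨⟨⟨x, hx⟩, hexp⟩, hne⟩ := hF
  obtain ⟨l, hl⟩ := hexp ⟨x, hx⟩
  have hsub : F ⊆ P := by rw [hl]; exact fun y hy => hy.1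
  have hle : vectorSpan ℝ F ≤ vectorSpan ℝ P := vectorSpan_mono ℝ hsub
  refine Submodule.finrank_lt_finrank_of_lt (lt_of_le_of_ne hle fun heq => hne ?_)
  refine Set.Subset.antisymm hsub fun y hy => ?_
  have hker : vectorSpan ℝ F ≤ LinearMap.ker (l : E →ₗ[ℝ] ℝ) := by
    rw [vectorSpan_def, Submodule.span_le]
    rintro _ ⟨a, ha, b, hb, rfl⟩
    have ha' := ha
    have hb' := hb
    rw [hl] at ha' hb'
    have h1 := ha'.2 b hb'.1
    have h2 := hb'.2 a ha'.1
    simp only [SetLike.mem_coe, LinearMap.mem_ker, vsub_eq_sub, map_sub]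
    exact sub_eq_zero.2 (le_antisymm h2 h1)
  have hmem : y - x ∈ vectorSpan ℝ F := by
    rw [heq]; exact vsub_mem_vectorSpan ℝ hy (hsub hx)
  have h0 : l (y - x) = 0 := hker hmem
  rw [map_sub, sub_eq_zero] at h0
  have hx' := hx
  rw [hl] at hx' ⊢
  exact ⟨hy, fun z hz => h0 ▸ hx'.2 z hz⟩

/-- The simultaneous recursion, on the dimension of `P` and on `n`, behind the polytope numbers
`P(n)` (flag `false`) and the interior polytope numbers of `P` (flag `true`). The function `v`
gives the apex `v F` of each face `F`. -/
def numberAux [FiniteDimensional ℝ E] (v : Set E → E) (interior : Bool) (P : Set E) (n : ℕ) : ℤ :=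
  match n with
  | 0 => 0
  | 1 => if dim P = 0 then 1 else if interior then 0 else 1
  | n + 2 =>
    if dim P = 0 then 1
    else match interior with
      | false => numberAux v false P (n + 1) +
          ∑ᶠ (F : Set E) (_ : F ∈ properFaces P ∧ v P ∉ F), numberAux v true F (n + 2)
      | true => numberAux v false P (n + 2) -
          ∑ᶠ (F : Set E) (_ : F ∈ properFaces P), numberAux v true F (n + 2)
termination_by (dim P, n, interior.toNat)
decreasing_by
  · exact Prod.Lex.right _ (Prod.Lex.left _ _ (by omega))
  · exact Prod.Lex.left _ _ (dim_lt_of_mem_properFaces (by tauto))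
  · exact Prod.Lex.right _ (Prod.Lex.right _ (by simp))
  · exact Prod.Lex.left _ _ (dim_lt_of_mem_properFaces (by assumption))

/-- The polytope numbers `P(n)` with respect to the apexes `v`. -/
def polytopeNumber [FiniteDimensional ℝ E] (v : Set E → E) (P : Set E) (n : ℕ) : ℤ :=
  numberAux v false P n

/-- The interior polytope numbers of `P` with respect to the apexes `v`. -/
def interiorNumber [FiniteDimensional ℝ E] (v : Set E → E) (P : Set E) (n : ℕ) : ℤ :=
  numberAux v true P n

/-! The recursion in its usual form. -/

section Recursion

variable [FiniteDimensional ℝ E] (v : Set E → E) (P : Set E)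

theorem polytopeNumber_zero : polytopeNumber v P 0 = 0 := by
  rw [polytopeNumber, numberAux]

theorem interiorNumber_zero : interiorNumber v P 0 = 0 := by
  rw [interiorNumber, numberAux]

theorem polytopeNumber_of_dim_eq_zero (hP : dim P = 0) (n : ℕ) (hn : 1 ≤ n) :
    polytopeNumber v P n = 1 := by
  match n, hn with
  | 1, _ => rw [polytopeNumber, numberAux, if_pos hP]
  | n + 2, _ => rw [polytopeNumber, numberAux, if_pos hP]

theorem interiorNumber_of_dim_eq_zero (hP : dim P = 0) (n : ℕ) (hn : 1 ≤ n) :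
    interiorNumber v P n = 1 := by
  match n, hn with
  | 1, _ => rw [interiorNumber, numberAux, if_pos hP]
  | n + 2, _ => rw [interiorNumber, numberAux, if_pos hP]

theorem polytopeNumber_one : polytopeNumber v P 1 = 1 := by
  rw [polytopeNumber, numberAux]; simp

theorem interiorNumber_one (hP : dim P ≠ 0) : interiorNumber v P 1 = 0 := by
  rw [interiorNumber, numberAux]; simp [hP]

theorem polytopeNumber_add_two (hP : dim P ≠ 0) (n : ℕ) :
    polytopeNumber v P (n + 2) = polytopeNumber v P (n + 1) +
      ∑ᶠ (F : Set E) (_ : F ∈ properFaces P ∧ v P ∉ F), interiorNumber v F (n + 2) := by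
  rw [polytopeNumber, numberAux, if_neg hP]; rfl

theorem interiorNumber_add_two (hP : dim P ≠ 0) (n : ℕ) :
    interiorNumber v P (n + 2) = polytopeNumber v P (n + 2) -
      ∑ᶠ (F : Set E) (_ : F ∈ properFaces P), interiorNumber v F (n + 2) := by
  rw [interiorNumber, numberAux, if_neg hP]; rfl

end Recursion

/-- `v` chooses an apex of each nonempty face of `P`: a vertex of that face, where two faces whose
apexes both lie in their intersection have the same apex. -/
structure IsApexChoice (v : Set E → E) (P : Set E) : Prop where
  mem_vert : ∀ F ∈ faces P, v F ∈ F.extremePoints ℝ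
  compatible : ∀ F₁ ∈ faces P, ∀ F₂ ∈ faces P,
    v F₁ ∈ F₁ ∩ F₂ → v F₂ ∈ F₁ ∩ F₂ → v F₁ = v F₂

/-- The (nonempty) simplices of `C`, given by their vertex sets, that lie in `F`. -/
def simplicesIn (C : Geometry.SimplicialComplex ℝ E) (F : Set E) : Set (Finset E) :=
  {s | s ∈ C.faces ∧ convexHull ℝ (s : Set E) ⊆ F}

/-- `C` is a pointed triangulation of `P` with the apexes `v F`, `F` a nonempty face of `P`. -/
structure IsPointedTriangulation (C : Geometry.SimplicialComplex ℝ E) (v : Set E → E)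
    (P : Set E) : Prop where
  finite : C.faces.Finite
  space_eq : C.space = P
  apexChoice : IsApexChoice v P
  /-- `C` restricts to a triangulation of each nonempty face `F` of `P`, -/
  face_space_eq : ∀ F ∈ faces P, ⋃ s ∈ simplicesIn C F, convexHull ℝ (s : Set E) = F
  /-- which is pure of dimension `dim F`, -/
  face_pure : ∀ F ∈ faces P, ∀ s ∈ simplicesIn C F,
    ∃ t ∈ simplicesIn C F, s ⊆ t ∧ t.card = dim F + 1
  /-- and whose simplices of that dimension all contain the apex of `F`. -/
  apex_mem : ∀ F ∈ faces P, ∀ t ∈ simplicesIn C F, t.card = dim F + 1 →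
    v F ∈ convexHull ℝ (t : Set E)
  /-- The segment from the apex of `F` to any other vertex of `F` is an edge of `C`. -/
  edge_mem : ∀ F ∈ faces P, ∀ w ∈ F.extremePoints ℝ, w ≠ v F →
    ∃ s ∈ simplicesIn C F, (s : Set E) = {v F, w}

/-- The number of `k`-simplices of `C`. -/
def numSimplices (C : Geometry.SimplicialComplex ℝ E) (k : ℕ) : ℕ :=
  Set.ncard {s | s ∈ C.faces ∧ s.card = k + 1}

/-- The point set (convex hull of the vertices) of a `k`-simplex. -/
def simplexSet {k : ℕ} (σ : Affine.Simplex ℝ E k) : Set E :=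
  convexHull ℝ (Set.range σ.points)

end

end Polytope

/-!
Each simplex of the triangulation is interior to a unique face of `P`, and the simplices in a face
`F` form a cone with apex `v F`. The simplices of its base, those without the vertex `v F`, are the
simplices in the proper faces of `F` that miss `v F`: by Farkas' lemma, if every face of `F` through
a point `x` contains `v F`, then the segment from `v F` to `x` can be prolonged in `F` beyond `x`,
so `x` is not interior to a simplex of the base. Counting a simplex on `j + 1` vertices with weight
`n.choose j`, the cone structure turns the recursion for the polytope numbers into Pascal's rule,
and hence `P(n + 2) = ∑ k, d_k * n.choose k`. The faces of a `k`-simplex are themselves such a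
triangulation, so that its polytope numbers are `(n + k).choose k` by Vandermonde's identity.
-/

namespace Polytope

section Farkas

variable {V : Type*} [AddCommGroup V] [Module ℝ V] [TopologicalSpace V] [IsTopologicalAddGroup V]
  [ContinuousSMul ℝ V]

/-- The projection of `V` onto the kernel of `l` along `a`, for `l a ≠ 0`; it eliminates
a generator in the inductive proof of Farkas' lemma. -/
noncomputable def kerProjection (l : StrongDual ℝ V) (a : V) : V →L[ℝ] V :=
  .id ℝ V - ((l a)⁻¹ • l).smulRight a

theorem kerProjection_apply (l : StrongDual ℝ V) (a x : V) :
    kerProjection l a x = x - ((l a)⁻¹ * l x) • a := rfl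

theorem kerProjection_self {l : StrongDual ℝ V} {a : V} (ha : l a ≠ 0) :
    kerProjection l a a = 0 := by
  rw [kerProjection_apply, inv_mul_cancel₀ ha, one_smul, sub_self]

theorem kerProjection_notMem_hull_image {s : Set V} {a b : V} {l : StrongDual ℝ V}
    (hs : ∀ x ∈ s, l x ≤ 0) (ha : 0 < l a) (hb : 0 < l b)
    (hbs : b ∉ PointedCone.hull ℝ (insert a s)) :
    kerProjection l a b ∉ PointedCone.hull ℝ (kerProjection l a '' s) := by
  intro h
  have h_map :
      kerProjection l a b ∈ (PointedCone.hull ℝ s).map (kerProjection l a).toLinearMap := by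
    rwa [PointedCone.map, Submodule.map_span]
  obtain ⟨c, hc, hcb⟩ := PointedCone.mem_map.1 h_map
  have h_nonpos : PointedCone.hull ℝ s ≤ (PointedCone.positive ℝ ℝ).comap (-l).toLinearMap :=
    Submodule.span_le.2 fun x hx => by simpa using hs x hx
  have hlc : l c ≤ 0 := by simpa using h_nonpos hc
  refine hbs (Submodule.mem_span_insert.2
    ⟨⟨(l a)⁻¹ * (l b - l c), mul_nonneg (inv_nonneg.2 ha.le) (by linarith)⟩, c, hc, ?_⟩)
  rw [ContinuousLinearMap.coe_coe, kerProjection_apply, kerProjection_apply] at hcb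
  rw [Nonneg.mk_smul]
  linear_combination (norm := module) -hcb

theorem exists_strongDual_of_notMem_hull_image [SeparatingDual ℝ V] {ι : Type*} {s : Finset ι}
    {a : ι → V} {b : V} (hb : b ∉ PointedCone.hull ℝ (a '' s)) :
    ∃ l : StrongDual ℝ V, (∀ i ∈ s, l (a i) ≤ 0) ∧ 0 < l b := by
  classical
  induction s using Finset.induction generalizing a b with
  | empty =>
    obtain ⟨l, hl⟩ := SeparatingDual.exists_eq_one (R := ℝ) (x := b) (by simpa using hb)
    exact ⟨l, by simp, by simp [hl]⟩
  | insert j s _ ih =>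
    rw [Finset.coe_insert, Set.image_insert_eq] at hb
    obtain ⟨l₀, hl₀, hl₀b⟩ := ih fun h => hb (Submodule.span_mono (Set.subset_insert _ _) h)
    obtain hj | hj := le_or_gt (l₀ (a j)) 0
    · exact ⟨l₀, by simpa using ⟨hj, hl₀⟩, hl₀b⟩
    -- Project along `a j`: a functional on the kernel of `l₀`, composed with this projection,
    -- vanishes at `a j`.
    have hπb := kerProjection_notMem_hull_image (by simpa using hl₀) hj hl₀b hb
    rw [Set.image_image] at hπb
    obtain ⟨l, hl, hlb⟩ := ih hπb
    exact ⟨l ∘L kerProjection l₀ (a j), by simpa [kerProjection_self hj.ne'] using hl, hlb⟩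

end Farkas

section Convexity

variable {V : Type*} [AddCommGroup V] [Module ℝ V]

theorem exists_add_smul_mem_of_mem_hull {A : Set V} {x u : V} (hA : Convex ℝ A) (hx : x ∈ A)
    (hu : u ∈ PointedCone.hull ℝ ((· - x) '' A)) : ∃ ε : ℝ, 0 < ε ∧ x + ε • u ∈ A := by
  induction hu using Submodule.span_induction with
  | mem u hu =>
    obtain ⟨y, hy, rfl⟩ := hu
    exact ⟨1, one_pos, by simpa using hy⟩
  | zero => exact ⟨1, one_pos, by simpa using hx⟩
  | add u₁ u₂ _ _ h₁ h₂ =>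
    obtain ⟨ε₁, hε₁, h₁⟩ := h₁
    obtain ⟨ε₂, hε₂, h₂⟩ := h₂
    refine ⟨ε₁ * ε₂ / (ε₁ + ε₂), by positivity, ?_⟩
    convert hA h₁ h₂ (a := ε₂ / (ε₁ + ε₂)) (b := ε₁ / (ε₁ + ε₂)) (by positivity) (by positivity)
      (by field_simp; ring) using 1
    match_scalars <;> field_simp
    ring
  | smul r u _ h =>
    obtain ⟨ε, hε, h⟩ := h
    obtain rfl | hr := eq_zero_or_pos r
    · exact ⟨1, one_pos, by simpa using hx⟩
    · have hr' : (0 : ℝ) < r := hr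
      refine ⟨ε / r, by positivity, ?_⟩
      rwa [Nonneg.mk_smul, smul_smul, div_mul_cancel₀ _ hr'.ne']

theorem mem_openSegment_add_smul_sub (v x : V) {ε : ℝ} (hε : 0 < ε) :
    x ∈ openSegment ℝ v (x + ε • (x - v)) := by
  refine ⟨ε / (1 + ε), 1 / (1 + ε), by positivity, by positivity,
    by field_simp; ring, ?_⟩
  match_scalars <;> field_simp
  ring

theorem mem_of_isExtreme_of_sum_mem {A B : Set V} {t : Finset V} {w : V → ℝ} {p : V}
    (hA : Convex ℝ A) (hB : IsExtreme ℝ A B) (ht : (t : Set V) ⊆ A) (hw₀ : ∀ q ∈ t, 0 ≤ w q)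
    (hw₁ : ∑ q ∈ t, w q = 1) (hw : ∑ q ∈ t, w q • q ∈ B) (hp : p ∈ t) (hwp : 0 < w p) :
    p ∈ B := by
  classical
  have h_split := Finset.add_sum_erase t w hp
  have h_nonneg : ∀ q ∈ t.erase p, 0 ≤ w q := fun q hq => hw₀ q (Finset.mem_of_mem_erase hq)
  have h_rest : ∑ q ∈ t.erase p, w q = 1 - w p := by linarith
  rw [← Finset.add_sum_erase t _ hp] at hw
  obtain h_zero | h_pos := (Finset.sum_nonneg h_nonneg).eq_or_lt'
  · have h_weights := (Finset.sum_eq_zero_iff_of_nonneg h_nonneg).1 h_zero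
    rw [Finset.sum_eq_zero fun q hq => by rw [h_weights q hq, zero_smul], add_zero,
      show w p = 1 by linarith, one_smul] at hw
    exact hw
  · set y := (t.erase p).centerMass w id with hy
    have hyA : y ∈ A := hA.centerMass_mem h_nonneg h_pos fun q hq =>
      ht (Finset.mem_of_mem_erase hq)
    refine hB.left_mem_of_mem_openSegment (ht hp) hyA hw
      ⟨w p, 1 - w p, hwp, by linarith, by ring, ?_⟩
    rw [hy, Finset.centerMass, h_rest, smul_inv_smul₀ (by linarith)]
    rfl

theorem mem_convexHull_inter_of_isExtreme {A B s : Set V} {x : V} (hA : Convex ℝ A)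
    (hB : IsExtreme ℝ A B) (hs : s ⊆ A) (hx : x ∈ convexHull ℝ s) (hxB : x ∈ B) :
    x ∈ convexHull ℝ (s ∩ B) := by
  rw [convexHull_eq_union_convexHull_finite_subsets] at hx
  simp only [Set.mem_iUnion] at hx
  obtain ⟨t, hts, hx⟩ := hx
  obtain ⟨w, hw₀, hw₁, rfl⟩ := Finset.mem_convexHull'.1 hx
  have h_sum : ∑ q ∈ t with 0 < w q, w q • q = ∑ q ∈ t, w q • q :=
    Finset.sum_filter_of_ne fun q hq h => (hw₀ q hq).lt_of_ne' fun h₀ => h (by rw [h₀, zero_smul])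
  rw [← h_sum]
  refine (convex_convexHull ℝ _).sum_mem (fun q hq => hw₀ q (Finset.mem_filter.1 hq).1) ?_
    fun q hq => subset_convexHull ℝ _ ?_
  · rw [Finset.sum_filter_of_ne fun q hq h => (hw₀ q hq).lt_of_ne' h, hw₁]
  · obtain ⟨hqt, hq⟩ := Finset.mem_filter.1 hq
    exact ⟨hts hqt, mem_of_isExtreme_of_sum_mem hA hB (hts.trans hs) hw₀ hw₁ hxB hqt hq⟩

theorem subset_of_centroid_mem_of_isExtreme {A B : Set V} {t : Finset V} (hA : Convex ℝ A)
    (hB : IsExtreme ℝ A B) (ht : (t : Set V) ⊆ A) (htB : t.centroid ℝ id ∈ B) :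
    (t : Set V) ⊆ B := by
  intro p hp
  have h_ne : t.Nonempty := ⟨p, hp⟩
  have h_sum := t.sum_centroidWeights_eq_one_of_nonempty ℝ h_ne
  rw [t.centroid_eq_centerMass h_ne, t.centerMass_eq_of_sum_1 _ h_sum] at htB
  refine mem_of_isExtreme_of_sum_mem hA hB ht (fun q _ => ?_) h_sum htB hp ?_ <;>
    simp [Finset.card_pos.2 h_ne]

theorem convexHull_inter_eq_of_isExtreme {s F : Set V} (hF : IsExtreme ℝ (convexHull ℝ s) F)
    (hFc : Convex ℝ F) : convexHull ℝ (s ∩ F) = F :=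
  (convexHull_min Set.inter_subset_right hFc).antisymm fun _ hx =>
    mem_convexHull_inter_of_isExtreme (convex_convexHull ℝ s) hF (subset_convexHull ℝ s)
      (hF.subset hx) hx

theorem isExtreme_convexHull_of_affineIndependent {t u : Finset V}
    (ht : AffineIndependent ℝ ((↑) : t → V)) (hut : u ⊆ t) :
    IsExtreme ℝ (convexHull ℝ (t : Set V)) (convexHull ℝ (u : Set V)) := by
  classical
  refine ⟨convexHull_mono (Finset.coe_subset.2 hut), ?_⟩
  rintro x hx y hy z hz ⟨a, b, ha, hb, hab, rfl⟩
  obtain ⟨f, hf₀, hf₁, rfl⟩ := Finset.mem_convexHull'.1 hx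
  obtain ⟨g, hg₀, hg₁, rfl⟩ := Finset.mem_convexHull'.1 hy
  obtain ⟨h, -, h₁, hh⟩ := Finset.mem_convexHull'.1 hz
  have h_weights : ∀ p ∈ t, a * f p + b * g p = if p ∈ u then h p else 0 := by
    refine ht.eq_of_sum_eq_sum_subtype ?_ ?_
    · rw [Finset.sum_add_distrib, ← Finset.mul_sum, ← Finset.mul_sum, hf₁, hg₁, mul_one, mul_one,
        hab, Finset.sum_ite_mem, Finset.inter_eq_right.2 hut, h₁]
    · simp only [ite_smul, zero_smul, add_smul, mul_smul, Finset.sum_add_distrib, ← Finset.smul_sum]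
      rw [Finset.sum_ite_mem, Finset.inter_eq_right.2 hut, hh]
  have h_supp : ∀ p ∈ t, p ∉ u → f p = 0 := fun p hp hpu => by
    have h_sum := h_weights p hp
    rw [if_neg hpu] at h_sum
    nlinarith [hf₀ p hp, mul_nonneg hb.le (hg₀ p hp)]
  rw [← Finset.sum_subset hut fun p hp hpu => by rw [h_supp p hp hpu, zero_smul]]
  refine (convex_convexHull ℝ _).sum_mem (fun p hp => hf₀ p (hut hp)) ?_
    fun p hp => subset_convexHull ℝ _ hp
  rw [Finset.sum_subset hut h_supp, hf₁]

theorem mem_of_mem_convexHull_of_affineIndependent {t u : Finset V} {p : V}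
    (ht : AffineIndependent ℝ ((↑) : t → V)) (hut : u ⊆ t) (hp : p ∈ t)
    (hpu : p ∈ convexHull ℝ (u : Set V)) : p ∈ u := by
  have h_inter : p ∈ convexHull ℝ (({p} : Finset V) ∩ u : Set V) := by
    rw [ht.convexHull_inter (Finset.singleton_subset_iff.2 hp) hut]
    exact ⟨by simp, hpu⟩
  obtain ⟨q, hq, hqu⟩ := convexHull_nonempty_iff.1 ⟨p, h_inter⟩
  rwa [← Finset.mem_singleton.1 hq]

end Convexity

section Faces

variable {E : Type*} [NormedAddCommGroup E] [NormedSpace ℝ E] {P F G : Set E}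

theorem subset_of_mem_faces (hF : F ∈ faces P) : F ⊆ P := hF.2.subset

theorem mem_faces_self (hP : P.Nonempty) : P ∈ faces P := ⟨hP, .refl P⟩

theorem mem_faces_of_subset (hF : F ∈ faces P) (hG : G ∈ faces P) (hGF : G ⊆ F) : G ∈ faces F :=
  ⟨hG.1, hG.2.mono (subset_of_mem_faces hF) hGF⟩

theorem inter_mem_faces (hF : F ∈ faces P) (hG : G ∈ faces P) (h : (F ∩ G).Nonempty) :
    F ∩ G ∈ faces P :=
  ⟨h, hF.2.inter hG.2⟩

theorem IsPolytope.nonempty (hP : IsPolytope P) : P.Nonempty := by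
  obtain ⟨s, hs, rfl⟩ := hP
  exact hs.to_set.convexHull

theorem IsPolytope.convex (hP : IsPolytope P) : Convex ℝ P := by
  obtain ⟨s, -, rfl⟩ := hP
  exact convex_convexHull ℝ _

theorem IsPolytope.of_isExtreme (hP : IsPolytope P) (hF : IsExtreme ℝ P F) (hFc : Convex ℝ F)
    (hFne : F.Nonempty) : IsPolytope F := by
  obtain ⟨s, -, rfl⟩ := hP
  have hF_eq := convexHull_inter_eq_of_isExtreme hF hFc
  have h_fin := s.finite_toSet.inter_of_left F
  refine ⟨h_fin.toFinset, h_fin.toFinset_nonempty.2 ?_, by rw [h_fin.coe_toFinset, hF_eq]⟩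
  rwa [← convexHull_nonempty_iff (𝕜 := ℝ), hF_eq]

theorem IsPolytope.of_mem_faces (hP : IsPolytope P) (hF : F ∈ faces P) : IsPolytope F :=
  hP.of_isExtreme hF.2.isExtreme (hF.2.convex hP.convex) hF.1

theorem IsPolytope.finite_faces (hP : IsPolytope P) : (faces P).Finite := by
  have hPc := hP.convex
  obtain ⟨s, -, rfl⟩ := hP
  refine (s.finite_toSet.finite_subsets.image (convexHull ℝ)).subset fun F hF => ?_
  exact ⟨s ∩ F, Set.inter_subset_left,
    convexHull_inter_eq_of_isExtreme hF.2.isExtreme (hF.2.convex hPc)⟩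

theorem IsPolytope.exists_least_face (hP : IsPolytope P) {t : Set E} (ht : t.Nonempty)
    (htP : t ⊆ P) : ∃ G ∈ faces P, t ⊆ G ∧ ∀ F ∈ faces P, t ⊆ F → G ⊆ F := by
  obtain ⟨G, ⟨hG, htG⟩, hG_min⟩ := (hP.finite_faces.subset (t := {F | F ∈ faces P ∧ t ⊆ F})
    fun F hF => hF.1).exists_minimal ⟨P, mem_faces_self hP.nonempty, htP⟩
  refine ⟨G, hG, htG, fun F hF htF => ?_⟩
  have h_sub := Set.subset_inter htG htF
  exact (hG_min ⟨inter_mem_faces hG hF (ht.mono h_sub), h_sub⟩ Set.inter_subset_left).trans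
    Set.inter_subset_right

theorem IsPolytope.exists_add_smul_sub_mem (hP : IsPolytope P) {x v : E} (hx : x ∈ P)
    (hv : ∀ G ∈ faces P, x ∈ G → v ∈ G) : ∃ ε : ℝ, 0 < ε ∧ x + ε • (x - v) ∈ P := by
  refine exists_add_smul_mem_of_mem_hull hP.convex hx ?_
  by_contra h_notMem
  obtain ⟨s, -, rfl⟩ := hP
  obtain ⟨l, hl, hlv⟩ := exists_strongDual_of_notMem_hull_image (a := (· - x)) (s := s)
    fun h => h_notMem (Submodule.span_mono (Set.image_mono (subset_convexHull ℝ _)) h)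
  have hl_max : ∀ y ∈ convexHull ℝ (s : Set E), l y ≤ l x := fun y hy =>
    convexHull_min (t := {y | l y ≤ l x}) (fun p hp => by simpa using hl p hp)
      (convex_halfSpace_le l.toLinearMap.isLinear _) hy
  have hx_exp : x ∈ l.toExposed (convexHull ℝ (s : Set E)) := ⟨hx, hl_max⟩
  have hv_exp := hv _ ⟨⟨x, hx_exp⟩, ContinuousLinearMap.toExposed.isExposed⟩ hx_exp
  have hxv := hv_exp.2 x hx
  rw [map_sub] at hlv
  linarith

theorem IsPolytope.mem_faces_of_isExtreme (hP : IsPolytope P) (hF : IsExtreme ℝ P F)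
    (hFc : Convex ℝ F) (hFne : F.Nonempty) : F ∈ faces P := by
  obtain ⟨t, ht, rfl⟩ := hP.of_isExtreme hF hFc hFne
  have hxF := t.centroid_mem_convexHull (R := ℝ) ht
  set x := t.centroid ℝ id
  obtain ⟨G, hG, hxG, hG_least⟩ :=
    hP.exists_least_face (Set.singleton_nonempty x) (Set.singleton_subset_iff.2 (hF.subset hxF))
  rw [Set.singleton_subset_iff] at hxG
  have hFG : convexHull ℝ (t : Set E) ⊆ G :=
    convexHull_min (subset_of_centroid_mem_of_isExtreme hP.convex hG.2.isExtreme
      ((subset_convexHull ℝ _).trans hF.subset) hxG) (hG.2.convex hP.convex)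
  have hGF : G ⊆ convexHull ℝ (t : Set E) := fun v hv => by
    obtain ⟨ε, hε, hy⟩ := hP.exists_add_smul_sub_mem (hF.subset hxF) fun H hH hxH =>
      hG_least H hH (Set.singleton_subset_iff.2 hxH) hv
    exact hF.left_mem_of_mem_openSegment (subset_of_mem_faces hG hv) hy hxF
      (mem_openSegment_add_smul_sub v x hε)
  exact hFG.antisymm hGF ▸ hG

theorem IsPolytope.mem_faces_trans (hP : IsPolytope P) (hF : F ∈ faces P) (hG : G ∈ faces F) :
    G ∈ faces P :=
  hP.mem_faces_of_isExtreme (hF.2.isExtreme.trans hG.2.isExtreme)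
    (hG.2.convex (hF.2.convex hP.convex)) hG.1

theorem IsPolytope.faces_subset_properFaces (hP : IsPolytope P) (hF : F ∈ properFaces P) :
    faces F ⊆ properFaces P := fun _ hG => ⟨hP.mem_faces_trans hF.1 hG, fun h =>
  hF.2 ((subset_of_mem_faces hF.1).antisymm (h ▸ subset_of_mem_faces hG))⟩

end Faces

section Triangulations

variable {E : Type*} [NormedAddCommGroup E] [NormedSpace ℝ E] {C : Geometry.SimplicialComplex ℝ E}
  {v : Set E → E} {P F : Set E} {s t : Finset E}

theorem dim_convexHull_add_one (hs : AffineIndependent ℝ ((↑) : s → E)) (h_ne : s.Nonempty) :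
    dim (convexHull ℝ (s : Set E)) + 1 = s.card := by
  have : Nonempty s := h_ne.coe_sort
  have h_dim : dim (Set.range ((↑) : s → E)) + 1 = s.card := by
    rw [dim, hs.finrank_vectorSpan_add_one, Fintype.card_coe]
  have h_range : Set.range ((↑) : s → E) = s := Subtype.range_coe
  rwa [dim, ← direction_affineSpan, affineSpan_convexHull, direction_affineSpan, ← h_range]

theorem mem_simplicesIn_of_subset (ht : t ∈ simplicesIn C F) (hst : s ⊆ t) (hs : s.Nonempty) :
    s ∈ simplicesIn C F :=
  ⟨C.down_closed ht.1 hst hs, (convexHull_mono (Finset.coe_subset.2 hst)).trans ht.2⟩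

theorem mem_simplicesIn_of_coe_subset (hF : Convex ℝ F) (hs : s ∈ C.faces)
    (hsF : (s : Set E) ⊆ F) : s ∈ simplicesIn C F :=
  ⟨hs, convexHull_min hsF hF⟩

theorem coe_subset_of_mem_simplicesIn (hs : s ∈ simplicesIn C F) : (s : Set E) ⊆ F :=
  (subset_convexHull ℝ _).trans hs.2

theorem exists_mem_simplicesIn_of_isExtreme (hF : IsExtreme ℝ C.space F) (hFc : Convex ℝ F)
    {x : E} (hx : x ∈ F) : ∃ s ∈ simplicesIn C F, x ∈ convexHull ℝ (s : Set E) := by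
  classical
  obtain ⟨s, hs, hxs⟩ := C.mem_space_iff.1 (hF.subset hx)
  have hF_inter : IsExtreme ℝ (convexHull ℝ (s : Set E)) (convexHull ℝ s ∩ F) :=
    ⟨Set.inter_subset_left, fun y hy z hz w hw hwyz =>
      ⟨hy, hF.2 (C.convexHull_subset_space hs hy) (C.convexHull_subset_space hs hz) hw.2 hwyz⟩⟩
  have hx_inter : x ∈ convexHull ℝ (s.filter (· ∈ F) : Set E) :=
    convexHull_mono (fun p hp => by simpa using ⟨hp.1, hp.2.2⟩)
      (mem_convexHull_inter_of_isExtreme (convex_convexHull ℝ _) hF_inter (subset_convexHull ℝ _)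
        hxs ⟨hxs, hx⟩)
  have h_ne : (s.filter (· ∈ F)).Nonempty := convexHull_nonempty_iff.1 ⟨x, hx_inter⟩
  exact ⟨_, mem_simplicesIn_of_coe_subset hFc (C.down_closed hs (Finset.filter_subset _ _) h_ne)
    fun p hp => (Finset.mem_filter.1 hp).2, hx_inter⟩

/-- `C` triangulates `P` in such a way that, for each face `F` of `P`, the simplices of `C` in `F`
form a cone with apex `v F`. In contrast to a pointed triangulation, the apexes need neither be
vertices of the faces nor be compatible with each other. -/
structure IsConicalTriangulation (C : Geometry.SimplicialComplex ℝ E) (v : Set E → E)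
    (P : Set E) : Prop where
  finite : C.faces.Finite
  space_eq : C.space = P
  exists_apex_mem : ∀ F ∈ faces P, ∀ s ∈ simplicesIn C F, ∃ t ∈ simplicesIn C F, s ⊆ t ∧ v F ∈ t

theorem IsPointedTriangulation.isConicalTriangulation (hC : IsPointedTriangulation C v P) :
    IsConicalTriangulation C v P where
  finite := hC.finite
  space_eq := hC.space_eq
  exists_apex_mem F hF s hs := by
    obtain ⟨t, ht, hst, h_card⟩ := hC.face_pure F hF s hs
    refine ⟨t, ht, hst, extremePoints_convexHull_subset (𝕜 := ℝ) ?_⟩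
    exact inter_extremePoints_subset_extremePoints_of_subset ht.2
      ⟨hC.apex_mem F hF t ht h_card, hC.apexChoice.mem_vert F hF⟩

namespace IsConicalTriangulation

theorem exists_mem_simplicesIn (hC : IsConicalTriangulation C v P) (hP : IsPolytope P)
    (hF : F ∈ faces P) {x : E} (hx : x ∈ F) :
    ∃ s ∈ simplicesIn C F, v F ∈ s ∧ x ∈ convexHull ℝ (s : Set E) := by
  obtain ⟨s, hs, hxs⟩ := exists_mem_simplicesIn_of_isExtreme
    (hC.space_eq ▸ hF.2.isExtreme) (hF.2.convex hP.convex) hx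
  obtain ⟨t, ht, hst, hvt⟩ := hC.exists_apex_mem F hF s hs
  exact ⟨t, ht, hvt, convexHull_mono (Finset.coe_subset.2 hst) hxs⟩

theorem singleton_apex_mem (hC : IsConicalTriangulation C v P) (hP : IsPolytope P)
    (hF : F ∈ faces P) : {v F} ∈ simplicesIn C F := by
  obtain ⟨x, hx⟩ := hF.1
  obtain ⟨s, hs, hvs, -⟩ := hC.exists_mem_simplicesIn hP hF hx
  exact mem_simplicesIn_of_subset hs (Finset.singleton_subset_iff.2 hvs) (by simp)

theorem apex_mem (hC : IsConicalTriangulation C v P) (hP : IsPolytope P) (hF : F ∈ faces P) :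
    v F ∈ F := by
  simpa using coe_subset_of_mem_simplicesIn (hC.singleton_apex_mem hP hF)

theorem insert_apex_mem [DecidableEq E] (hC : IsConicalTriangulation C v P) (hF : F ∈ faces P)
    (hs : s ∈ simplicesIn C F) : insert (v F) s ∈ simplicesIn C F := by
  obtain ⟨t, ht, hst, hvt⟩ := hC.exists_apex_mem F hF s hs
  exact mem_simplicesIn_of_subset ht (Finset.insert_subset hvt hst) (by simp)

theorem exists_face_apex_notMem (hC : IsConicalTriangulation C v P) (hP : IsPolytope P)
    (hF : F ∈ faces P) (hs : s ∈ simplicesIn C F) (hvs : v F ∉ s) :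
    ∃ G ∈ properFaces F, v F ∉ G ∧ s ∈ simplicesIn C G := by
  classical
  have hFP := hP.of_mem_faces hF
  have hxs := s.centroid_mem_convexHull (R := ℝ) (C.nonempty_of_mem_faces hs.1)
  set x := s.centroid ℝ id
  suffices h : ∃ G ∈ faces F, x ∈ G ∧ v F ∉ G by
    obtain ⟨G, hG, hxG, hvG⟩ := h
    have hsG := subset_of_centroid_mem_of_isExtreme hFP.convex hG.2.isExtreme
      (coe_subset_of_mem_simplicesIn hs) hxG
    exact ⟨G, ⟨hG, ne_of_mem_of_not_mem' (hC.apex_mem hP hF) hvG |>.symm⟩, hvG,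
      mem_simplicesIn_of_coe_subset (hG.2.convex hFP.convex) hs.1 hsG⟩
  by_contra! h_faces
  obtain ⟨ε, hε, hy⟩ := hFP.exists_add_smul_sub_mem (hs.2 hxs) h_faces
  obtain ⟨u, hu, hvu, hyu⟩ := hC.exists_mem_simplicesIn hP hF hy
  have hvu' := subset_convexHull ℝ (u : Set E) hvu
  have hx_seg := mem_openSegment_add_smul_sub (v F) x hε
  have hxu := (convex_convexHull ℝ (u : Set E)).openSegment_subset hvu' hyu hx_seg
  have hxsu : x ∈ convexHull ℝ ((s ∩ u : Finset E) : Set E) := by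
    rw [Finset.coe_inter]
    exact C.inter_subset_convexHull hs.1 hu.1 ⟨hxs, hxu⟩
  have hvsu := (isExtreme_convexHull_of_affineIndependent (C.indep hu.1)
    Finset.inter_subset_right).left_mem_of_mem_openSegment hvu' hyu hxsu hx_seg
  exact hvs (Finset.mem_of_mem_inter_left (mem_of_mem_convexHull_of_affineIndependent
    (C.indep hu.1) Finset.inter_subset_right hvu hvsu))

end IsConicalTriangulation

end Triangulations

section Counting

variable {E : Type*} [NormedAddCommGroup E] [NormedSpace ℝ E] {C : Geometry.SimplicialComplex ℝ E}
  {v : Set E → E} {P F G : Set E} {s : Finset E}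

/-- The simplices of `C` in `F` that lie in no proper face of `F`; they are the simplices that
the interior polytope numbers of `F` count. -/
def interiorSimplices (C : Geometry.SimplicialComplex ℝ E) (F : Set E) : Set (Finset E) :=
  simplicesIn C F \ ⋃ G ∈ properFaces F, simplicesIn C G

/-- The simplices of `C` in `F` that avoid the vertex `a`; they form the base of `F` when the
simplices of `C` in `F` form a cone with apex `a`. -/
def baseSimplices (C : Geometry.SimplicialComplex ℝ E) (F : Set E) (a : E) : Set (Finset E) :=
  {s | s ∈ simplicesIn C F ∧ a ∉ s}

theorem nonempty_of_mem_simplicesIn (hs : s ∈ simplicesIn C F) : s.Nonempty :=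
  C.nonempty_of_mem_faces hs.1

theorem finite_simplicesIn (hC : C.faces.Finite) : (simplicesIn C F).Finite :=
  hC.subset fun _ hs => hs.1

theorem exists_mem_interiorSimplices (hP : IsPolytope P) (hs : s ∈ simplicesIn C P) :
    ∃ G ∈ faces P, s ∈ interiorSimplices C G := by
  obtain ⟨G, hG, hsG, hG_least⟩ := hP.exists_least_face
    (nonempty_of_mem_simplicesIn hs).to_set.convexHull hs.2
  refine ⟨G, hG, ⟨hs.1, hsG⟩, ?_⟩
  simp only [Set.mem_iUnion, not_exists]
  exact fun H hH hsH => hH.2 ((subset_of_mem_faces hH.1).antisymm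
    (hG_least H (hP.mem_faces_trans hG hH.1) hsH.2))

theorem subset_of_mem_interiorSimplices (hF : F ∈ faces P) (hG : G ∈ faces P)
    (hsF : s ∈ interiorSimplices C F) (hsG : s ∈ simplicesIn C G) : F ⊆ G := by
  have hs_inter := Set.subset_inter hsF.1.2 hsG.2
  have h_face := inter_mem_faces hF hG
    ((nonempty_of_mem_simplicesIn hsG).to_set.convexHull.mono hs_inter)
  by_contra h
  exact hsF.2 (Set.mem_biUnion ⟨mem_faces_of_subset hF h_face Set.inter_subset_left,
    fun h_eq => h (Set.inter_eq_left.1 h_eq)⟩ ⟨hsG.1, hs_inter⟩)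

theorem pairwiseDisjoint_interiorSimplices :
    (faces P).PairwiseDisjoint (interiorSimplices C) := fun _F hF _G hG hFG =>
  Set.disjoint_left.2 fun _s hsF hsG => hFG <|
    (subset_of_mem_interiorSimplices hF hG hsF hsG.1).antisymm
      (subset_of_mem_interiorSimplices hG hF hsG hsF.1)

theorem biUnion_interiorSimplices (hP : IsPolytope P) {𝒢 : Set (Set E)} (h𝒢 : 𝒢 ⊆ faces P)
    (h_lower : ∀ G ∈ 𝒢, faces G ⊆ 𝒢) :
    ⋃ G ∈ 𝒢, interiorSimplices C G = ⋃ G ∈ 𝒢, simplicesIn C G := by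
  refine (Set.iUnion₂_mono fun G _ => Set.sdiff_subset).antisymm
    (Set.iUnion₂_subset fun G hG s hs => ?_)
  obtain ⟨H, hH, hsH⟩ := exists_mem_interiorSimplices (hP.of_mem_faces (h𝒢 hG)) hs
  exact Set.mem_biUnion (h_lower G hG hH) hsH

theorem finsum_interiorSimplices {M : Type*} [AddCommMonoid M] (hP : IsPolytope P)
    (hC : C.faces.Finite) {𝒢 : Set (Set E)} (h𝒢 : 𝒢 ⊆ faces P) (h_lower : ∀ G ∈ 𝒢, faces G ⊆ 𝒢)
    (f : Finset E → M) :
    ∑ᶠ G ∈ 𝒢, ∑ᶠ s ∈ interiorSimplices C G, f s = ∑ᶠ s ∈ ⋃ G ∈ 𝒢, simplicesIn C G, f s := by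
  rw [← biUnion_interiorSimplices hP h𝒢 h_lower,
    finsum_mem_biUnion (pairwiseDisjoint_interiorSimplices.subset h𝒢) (hP.finite_faces.subset h𝒢)
      fun G _ => (finite_simplicesIn hC).subset Set.sdiff_subset]

theorem choose_pred_card_add_choose_card {α : Type*} {s : Finset α} (hs : s.Nonempty) (n : ℕ) :
    n.choose (s.card - 1) + n.choose s.card = (n + 1).choose s.card := by
  obtain ⟨k, hk⟩ := Nat.exists_eq_add_one.2 hs.card_pos
  rw [hk, Nat.add_sub_cancel, Nat.choose_succ_succ]

namespace IsConicalTriangulation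

theorem baseSimplices_eq_biUnion (hC : IsConicalTriangulation C v P) (hP : IsPolytope P)
    (hF : F ∈ faces P) :
    baseSimplices C F (v F) = ⋃ G ∈ {G | G ∈ properFaces F ∧ v F ∉ G}, simplicesIn C G := by
  ext s
  simp only [Set.mem_iUnion]
  constructor
  · rintro ⟨hs, hvs⟩
    obtain ⟨G, hG, hvG, hsG⟩ := hC.exists_face_apex_notMem hP hF hs hvs
    exact ⟨G, ⟨hG, hvG⟩, hsG⟩
  · rintro ⟨G, ⟨hG, hvG⟩, hsG⟩
    exact ⟨⟨hsG.1, hsG.2.trans (subset_of_mem_faces hG.1)⟩,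
      fun hvs => hvG (coe_subset_of_mem_simplicesIn hsG hvs)⟩

theorem simplicesIn_eq [DecidableEq E] (hC : IsConicalTriangulation C v P) (hP : IsPolytope P)
    (hF : F ∈ faces P) :
    simplicesIn C F = insert {v F}
      (baseSimplices C F (v F) ∪ insert (v F) '' baseSimplices C F (v F)) := by
  ext s
  constructor
  · intro hs
    by_cases hvs : v F ∈ s
    · obtain h_empty | h_ne := (s.erase (v F)).eq_empty_or_nonempty
      · left
        rw [← Finset.insert_erase hvs, h_empty, insert_empty_eq]
      · exact .inr (.inr ⟨s.erase (v F), ⟨mem_simplicesIn_of_subset hs (Finset.erase_subset _ _)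
          h_ne, Finset.notMem_erase _ _⟩, Finset.insert_erase hvs⟩)
    · exact .inr (.inl ⟨hs, hvs⟩)
  · rintro (rfl | hs | ⟨s, hs, rfl⟩)
    exacts [hC.singleton_apex_mem hP hF, hs.1, hC.insert_apex_mem hF hs.1]

theorem finsum_simplicesIn [DecidableEq E] {M : Type*} [AddCommMonoid M]
    (hC : IsConicalTriangulation C v P) (hP : IsPolytope P) (hF : F ∈ faces P)
    (f : Finset E → M) :
    ∑ᶠ s ∈ simplicesIn C F, f s =
      f {v F} + ∑ᶠ s ∈ baseSimplices C F (v F), (f s + f (insert (v F) s)) := by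
  have h_fin : (baseSimplices C F (v F)).Finite :=
    (finite_simplicesIn hC.finite).subset fun _ hs => hs.1
  have h_inj : Set.InjOn (insert (v F)) (baseSimplices C F (v F)) := fun s hs t ht hst => by
    rw [← Finset.erase_insert hs.2, hst, Finset.erase_insert ht.2]
  have h_disj : Disjoint (baseSimplices C F (v F)) (insert (v F) '' baseSimplices C F (v F)) :=
    Set.disjoint_left.2 fun s hs => by
      rintro ⟨t, -, rfl⟩
      exact hs.2 (Finset.mem_insert_self _ _)
  have h_apex : {v F} ∉
      baseSimplices C F (v F) ∪ insert (v F) '' baseSimplices C F (v F) := by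
    rintro (h | ⟨s, hs, hvs⟩)
    · exact h.2 (Finset.mem_singleton_self _)
    · obtain ⟨x, hx⟩ := nonempty_of_mem_simplicesIn hs.1
      have hxv : x ∈ ({v F} : Finset E) := hvs ▸ Finset.mem_insert_of_mem hx
      exact hs.2 (Finset.mem_singleton.1 hxv ▸ hx)
  rw [hC.simplicesIn_eq hP hF, finsum_mem_insert _ h_apex (h_fin.union (h_fin.image _)),
    finsum_mem_union h_disj h_fin (h_fin.image _), finsum_mem_image h_inj,
    finsum_mem_add_distrib h_fin]

theorem finsum_simplicesIn_choose (hC : IsConicalTriangulation C v P) (hP : IsPolytope P)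
    (hF : F ∈ faces P) (n : ℕ) :
    ∑ᶠ s ∈ simplicesIn C F, (n.choose (s.card - 1) : ℤ) =
      1 + ∑ᶠ s ∈ baseSimplices C F (v F), ((n + 1).choose s.card : ℤ) := by
  classical
  rw [hC.finsum_simplicesIn hP hF, Finset.card_singleton, Nat.sub_self, Nat.choose_zero_right,
    Nat.cast_one]
  congr 1
  refine finsum_mem_congr rfl fun s hs => ?_
  rw [Finset.card_insert_of_notMem hs.2, Nat.add_sub_cancel, ← Nat.cast_add,
    choose_pred_card_add_choose_card (nonempty_of_mem_simplicesIn hs.1)]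

end IsConicalTriangulation

end Counting

section Numbers

variable {E : Type*} [NormedAddCommGroup E] [NormedSpace ℝ E] [FiniteDimensional ℝ E]
  {C : Geometry.SimplicialComplex ℝ E} {v : Set E → E} {P F : Set E}

theorem properFaces_eq_empty_of_dim_eq_zero (hP : dim P = 0) : properFaces P = ∅ :=
  Set.eq_empty_of_forall_notMem fun _ hF => by
    have := dim_lt_of_mem_properFaces hF
    omega

theorem polytopeNumber_add_two_eq (v : Set E → E) (P : Set E) (n : ℕ) :
    polytopeNumber v P (n + 2) = polytopeNumber v P (n + 1) +
      ∑ᶠ F ∈ {F | F ∈ properFaces P ∧ v P ∉ F}, interiorNumber v F (n + 2) := by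
  by_cases hP : dim P = 0
  · simp [polytopeNumber_of_dim_eq_zero, properFaces_eq_empty_of_dim_eq_zero, hP]
  · exact polytopeNumber_add_two v P hP n

theorem interiorNumber_add_two_eq (v : Set E → E) (P : Set E) (n : ℕ) :
    interiorNumber v P (n + 2) = polytopeNumber v P (n + 2) -
      ∑ᶠ F ∈ properFaces P, interiorNumber v F (n + 2) := by
  by_cases hP : dim P = 0
  · simp [polytopeNumber_of_dim_eq_zero, interiorNumber_of_dim_eq_zero,
      properFaces_eq_empty_of_dim_eq_zero, hP]
  · exact interiorNumber_add_two v P hP n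

theorem card_le_dim_space_add_one {s : Finset E} (hs : s ∈ C.faces) :
    s.card ≤ dim C.space + 1 := by
  rw [← dim_convexHull_add_one (C.indep hs) (C.nonempty_of_mem_faces hs)]
  exact Nat.succ_le_succ (Submodule.finrank_mono
    (vectorSpan_mono ℝ (C.convexHull_subset_space hs)))

theorem finsum_faces_card_sub_one {M : Type*} [AddCommMonoid M] (hC : C.faces.Finite)
    (f : ℕ → M) :
    ∑ᶠ s ∈ C.faces, f (s.card - 1) =
      ∑ k ∈ Finset.range (dim C.space + 1), numSimplices C k • f k := by
  classical
  have h_maps : ∀ s ∈ hC.toFinset, s.card - 1 ∈ Finset.range (dim C.space + 1) := fun s hs => by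
    have := card_le_dim_space_add_one (hC.mem_toFinset.1 hs)
    rw [Finset.mem_range]
    omega
  have h_count : ∀ k, (hC.toFinset.filter fun s => s.card - 1 = k).card = numSimplices C k :=
    fun k => by
      rw [numSimplices, ← Set.ncard_coe_finset]
      congr 1
      ext s
      simp only [Finset.coe_filter, Set.Finite.mem_toFinset, Set.mem_ofPred_eq]
      refine and_congr_right fun hs => ?_
      have := (C.nonempty_of_mem_faces hs).card_pos
      omega
  rw [finsum_mem_eq_finite_toFinset_sum _ hC, ← Finset.sum_fiberwise_of_maps_to h_maps]
  refine Finset.sum_congr rfl fun k _ => ?_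
  rw [← h_count, ← Finset.sum_const]
  exact Finset.sum_congr rfl fun s hs => by rw [(Finset.mem_filter.1 hs).2]

namespace IsConicalTriangulation

theorem polytopeNumber_succ_eq_finsum_baseSimplices (hC : IsConicalTriangulation C v P)
    (hP : IsPolytope P) (hF : F ∈ faces P)
    (h_interior : ∀ G ∈ properFaces F, ∀ n, interiorNumber v G (n + 2) =
      ∑ᶠ s ∈ interiorSimplices C G, (n.choose (s.card - 1) : ℤ)) (n : ℕ) :
    polytopeNumber v F (n + 1) = 1 + ∑ᶠ s ∈ baseSimplices C F (v F), (n.choose s.card : ℤ) := by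
  induction n with
  | zero =>
    rw [polytopeNumber_one, finsum_mem_of_eqOn_zero fun s hs => ?_, add_zero]
    rw [Nat.choose_eq_zero_of_lt (nonempty_of_mem_simplicesIn hs.1).card_pos]; rfl
  | succ n ih =>
    have hFP := hP.of_mem_faces hF
    have h_lower : ∀ G ∈ {G | G ∈ properFaces F ∧ v F ∉ G},
        faces G ⊆ {G | G ∈ properFaces F ∧ v F ∉ G} := fun G hG H hH =>
      ⟨hFP.faces_subset_properFaces hG.1 hH, fun hvH => hG.2 (subset_of_mem_faces hH hvH)⟩
    have h_fin : (baseSimplices C F (v F)).Finite :=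
      (finite_simplicesIn hC.finite).subset fun _ hs => hs.1
    rw [polytopeNumber_add_two_eq, ih, finsum_mem_congr rfl fun G hG => h_interior G hG.1 n,
      finsum_interiorSimplices hFP hC.finite (fun G hG => hG.1.1) h_lower,
      ← hC.baseSimplices_eq_biUnion hP hF, add_assoc, ← finsum_mem_add_distrib h_fin]
    congr 1
    refine finsum_mem_congr rfl fun s hs => ?_
    rw [← Nat.cast_add, add_comm,
      choose_pred_card_add_choose_card (nonempty_of_mem_simplicesIn hs.1)]

theorem polytopeNumber_add_two_of_forall_properFaces (hC : IsConicalTriangulation C v P)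
    (hP : IsPolytope P) (hF : F ∈ faces P)
    (h_interior : ∀ G ∈ properFaces F, ∀ n, interiorNumber v G (n + 2) =
      ∑ᶠ s ∈ interiorSimplices C G, (n.choose (s.card - 1) : ℤ)) (n : ℕ) :
    polytopeNumber v F (n + 2) = ∑ᶠ s ∈ simplicesIn C F, (n.choose (s.card - 1) : ℤ) := by
  rw [hC.polytopeNumber_succ_eq_finsum_baseSimplices hP hF h_interior,
    hC.finsum_simplicesIn_choose hP hF]

theorem interiorNumber_add_two_eq_finsum (hC : IsConicalTriangulation C v P)
    (hP : IsPolytope P) (hF : F ∈ faces P) (n : ℕ) :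
    interiorNumber v F (n + 2) = ∑ᶠ s ∈ interiorSimplices C F, (n.choose (s.card - 1) : ℤ) := by
  induction hd : dim F using Nat.strong_induction_on generalizing F n with
  | _ d ih =>
    have hFP := hP.of_mem_faces hF
    have h_interior := fun G (hG : G ∈ properFaces F) n =>
      ih (dim G) (hd ▸ dim_lt_of_mem_properFaces hG) (hP.mem_faces_trans hF hG.1) n rfl
    have h_boundary : ⋃ G ∈ properFaces F, simplicesIn C G ⊆ simplicesIn C F :=
      Set.iUnion₂_subset fun G hG s hs => ⟨hs.1, hs.2.trans (subset_of_mem_faces hG.1)⟩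
    rw [interiorNumber_add_two_eq, hC.polytopeNumber_add_two_of_forall_properFaces hP hF h_interior,
      finsum_mem_congr rfl fun G hG => h_interior G hG n,
      finsum_interiorSimplices hFP hC.finite (fun G hG => hG.1)
        fun G hG => hFP.faces_subset_properFaces hG,
      ← finsum_mem_add_sdiff h_boundary (finite_simplicesIn hC.finite), interiorSimplices,
      add_sub_cancel_left]

theorem polytopeNumber_add_two_eq_finsum (hC : IsConicalTriangulation C v P)
    (hP : IsPolytope P) (n : ℕ) :
    polytopeNumber v P (n + 2) = ∑ᶠ s ∈ C.faces, (n.choose (s.card - 1) : ℤ) := by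
  have hPP := mem_faces_self hP.nonempty
  have h_all : simplicesIn C P = C.faces :=
    Set.ext fun s => and_iff_left_of_imp fun hs => hC.space_eq ▸ C.convexHull_subset_space hs
  rw [← h_all, hC.polytopeNumber_add_two_of_forall_properFaces hP hPP fun G hG n =>
    hC.interiorNumber_add_two_eq_finsum hP hG.1 n]

theorem polytopeNumber_add_two_eq_sum_range (hC : IsConicalTriangulation C v P)
    (hP : IsPolytope P) (n : ℕ) :
    polytopeNumber v P (n + 2) =
      ∑ k ∈ Finset.range (dim P + 1), (numSimplices C k : ℤ) * n.choose k := by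
  rw [hC.polytopeNumber_add_two_eq_finsum hP,
    finsum_faces_card_sub_one hC.finite fun k => (n.choose k : ℤ), hC.space_eq]
  simp only [nsmul_eq_mul]

end IsConicalTriangulation

end Numbers

section Simplices

theorem sum_range_choose_mul_choose (n k : ℕ) :
    ∑ j ∈ Finset.range (k + 1), (k + 1).choose (j + 1) * n.choose j = (n + (k + 1)).choose k := by
  rw [Nat.add_choose_eq, Finset.Nat.sum_antidiagonal_eq_sum_range_succ_mk]
  refine Finset.sum_congr rfl fun j hj => ?_
  have hj' : j + 1 ≤ k + 1 := Nat.succ_le_of_lt (Finset.mem_range.1 hj)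
  rw [mul_comm, ← Nat.choose_symm hj', Nat.add_sub_add_right]

section Complex

variable {V : Type*} [AddCommGroup V] [Module ℝ V] {T : Finset V}

/-- The simplicial complex of all faces of the simplex with vertex set `T`. -/
def simplexComplex (T : Finset V) (hT : AffineIndependent ℝ ((↑) : T → V)) :
    Geometry.SimplicialComplex ℝ V where
  faces := {s | s.Nonempty ∧ s ⊆ T}
  isRelLowerSet_faces := fun _ hs => ⟨hs.1, fun _ hts ht => ⟨ht, hts.trans hs.2⟩⟩
  indep hs := hT.mono hs.2
  inter_subset_convexHull hs ht := (hT.convexHull_inter hs.2 ht.2).superset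

theorem mem_faces_simplexComplex {hT : AffineIndependent ℝ ((↑) : T → V)} {s : Finset V} :
    s ∈ (simplexComplex T hT).faces ↔ s.Nonempty ∧ s ⊆ T := Iff.rfl

theorem space_simplexComplex (hT : AffineIndependent ℝ ((↑) : T → V)) :
    (simplexComplex T hT).space = convexHull ℝ (T : Set V) := by
  ext x
  rw [Geometry.SimplicialComplex.mem_space_iff]
  exact ⟨fun ⟨s, hs, hx⟩ => convexHull_mono (Finset.coe_subset.2 hs.2) hx,
    fun hx => ⟨T, ⟨convexHull_nonempty_iff.1 ⟨x, hx⟩, subset_rfl⟩, hx⟩⟩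

end Complex

variable {E : Type*} [NormedAddCommGroup E] [NormedSpace ℝ E] {v : Set E → E} {T : Finset E}
  {k : ℕ}

theorem numSimplices_simplexComplex (hT : AffineIndependent ℝ ((↑) : T → E)) (j : ℕ) :
    numSimplices (simplexComplex T hT) j = T.card.choose (j + 1) := by
  rw [numSimplices, ← Finset.card_powersetCard, ← Set.ncard_coe_finset]
  congr 1
  ext s
  simp only [Set.mem_ofPred_eq, mem_faces_simplexComplex, Finset.mem_coe, Finset.mem_powersetCard]
  refine ⟨fun hs => ⟨hs.1.2, hs.2⟩, fun hs => ⟨⟨Finset.card_pos.1 ?_, hs.1⟩, hs.2⟩⟩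
  exact hs.2 ▸ j.succ_pos

theorem isConicalTriangulation_simplexComplex (hT : AffineIndependent ℝ ((↑) : T → E))
    (hv : ∀ F ∈ faces (convexHull ℝ (T : Set E)), v F ∈ F.extremePoints ℝ) :
    IsConicalTriangulation (simplexComplex T hT) v (convexHull ℝ (T : Set E)) where
  finite := T.powerset.finite_toSet.subset fun _ hs => Finset.mem_powerset.2 hs.2
  space_eq := space_simplexComplex hT
  exists_apex_mem F hF s hs := by
    classical
    have hvT : v F ∈ T := extremePoints_convexHull_subset
      (hF.2.isExtreme.extremePoints_subset_extremePoints (hv F hF))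
    have h_face : insert (v F) s ∈ (simplexComplex T hT).faces :=
      ⟨Finset.insert_nonempty _ _, Finset.insert_subset hvT hs.1.2⟩
    have h_sub : ((insert (v F) s : Finset E) : Set E) ⊆ F := by
      rw [Finset.coe_insert]
      exact Set.insert_subset (hv F hF).1 (coe_subset_of_mem_simplicesIn hs)
    exact ⟨_, mem_simplicesIn_of_coe_subset (hF.2.convex (convex_convexHull ℝ _)) h_face h_sub,
      Finset.subset_insert _ _, Finset.mem_insert_self _ _⟩

theorem polytopeNumber_convexHull_succ [FiniteDimensional ℝ E]
    (hT : AffineIndependent ℝ ((↑) : T → E)) (hk : T.card = k + 1)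
    (hv : ∀ F ∈ faces (convexHull ℝ (T : Set E)), v F ∈ F.extremePoints ℝ) (n : ℕ) :
    polytopeNumber v (convexHull ℝ (T : Set E)) (n + 1) = (n + k).choose k := by
  obtain _ | n := n
  · rw [polytopeNumber_one, Nat.zero_add, Nat.choose_self, Nat.cast_one]
  have h_ne : T.Nonempty := Finset.card_pos.1 (by omega)
  have hP : IsPolytope (convexHull ℝ (T : Set E)) := ⟨T, h_ne, rfl⟩
  have h_dim : dim (convexHull ℝ (T : Set E)) = k := by
    have := dim_convexHull_add_one hT h_ne
    omega
  rw [(isConicalTriangulation_simplexComplex hT hv).polytopeNumber_add_two_eq_sum_range hP,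
    h_dim, add_right_comm, add_assoc,
    ← sum_range_choose_mul_choose]
  push_cast
  simp only [numSimplices_simplexComplex, hk]

theorem exists_simplexSet_eq_convexHull (σ : Affine.Simplex ℝ E k) :
    ∃ T : Finset E, AffineIndependent ℝ ((↑) : T → E) ∧ T.card = k + 1 ∧
      simplexSet σ = convexHull ℝ (T : Set E) := by
  classical
  refine ⟨Finset.univ.image σ.points, ?_, ?_, by simp [simplexSet]⟩
  · have h_range := σ.independent.range
    rw [← Set.image_univ, ← Finset.coe_univ, ← Finset.coe_image] at h_range
    exact h_range
  · rw [Finset.card_image_of_injective _ σ.independent.injective, Finset.card_univ,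
      Fintype.card_fin]

theorem polytopeNumber_simplexSet_succ [FiniteDimensional ℝ E] (σ : Affine.Simplex ℝ E k)
    (hv : ∀ F ∈ faces (simplexSet σ), v F ∈ F.extremePoints ℝ) (n : ℕ) :
    polytopeNumber v (simplexSet σ) (n + 1) = (n + k).choose k := by
  obtain ⟨T, hT, hk, hσ⟩ := exists_simplexSet_eq_convexHull σ
  rw [hσ] at hv ⊢
  exact polytopeNumber_convexHull_succ hT hk hv n

theorem polytopeNumber_simplexSet_add_two_sub [FiniteDimensional ℝ E] (σ : Affine.Simplex ℝ E k)
    (hv : ∀ F ∈ faces (simplexSet σ), v F ∈ F.extremePoints ℝ) (n : ℕ) :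
    polytopeNumber v (simplexSet σ) (n + 2 - (k + 1)) = n.choose k := by
  obtain h_lt | h_le := lt_or_ge n k
  · rw [Nat.sub_eq_zero_of_le (by omega), polytopeNumber_zero, Nat.choose_eq_zero_of_lt h_lt,
      Nat.cast_zero]
  · obtain ⟨j, rfl⟩ := Nat.exists_eq_add_of_le' h_le
    rw [show j + k + 2 - (k + 1) = j + 1 by omega, polytopeNumber_simplexSet_succ σ hv]

end Simplices

end Polytope

theorem mainTheorem10_general {E : Type*} [NormedAddCommGroup E] [NormedSpace ℝ E]
    [FiniteDimensional ℝ E] (P : Set E) (hP : Polytope.IsPolytope P)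
    (C : Geometry.SimplicialComplex ℝ E) (v : Set E → E)
    (hC : Polytope.IsConicalTriangulation C v P)
    {E' : ℕ → Type*} [∀ k, NormedAddCommGroup (E' k)] [∀ k, NormedSpace ℝ (E' k)]
    [∀ k, FiniteDimensional ℝ (E' k)] (σ : ∀ k, Affine.Simplex ℝ (E' k) k)
    (w : ∀ k, Set (E' k) → E' k)
    (hw : ∀ k, ∀ F ∈ Polytope.faces (Polytope.simplexSet (σ k)), w k F ∈ F.extremePoints ℝ)
    (n : ℕ) (hn : n ≠ 1) :
    Polytope.polytopeNumber v P n =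
      ∑ k ∈ Finset.range (Polytope.dim P + 1),
        (Polytope.numSimplices C k : ℤ) *
          Polytope.polytopeNumber (w k) (Polytope.simplexSet (σ k)) (n - (k + 1)) := by
  match n, hn with
  | 0, _ => simp only [Nat.zero_sub, Polytope.polytopeNumber_zero, mul_zero, Finset.sum_const_zero]
  | n + 2, _ =>
    rw [hC.polytopeNumber_add_two_eq_sum_range hP]
    exact Finset.sum_congr rfl fun k _ => by
      rw [Polytope.polytopeNumber_simplexSet_add_two_sub (σ k) (hw k)]

/-- `σ k` is an arbitrary `k`-simplex with an arbitrary choice `w k` of apexes; its polytope numbers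
are the `k`-simplex numbers. They vanish at `0`, so the truncated subtraction `n - (k + 1)` says
that they are `0` at negative arguments. -/
theorem mainTheorem10 {E : Type*} [NormedAddCommGroup E] [NormedSpace ℝ E] [FiniteDimensional ℝ E]
    (P : Set E) (hP : Polytope.IsPolytope P)
    (C : Geometry.SimplicialComplex ℝ E) (v : Set E → E)
    (hC : Polytope.IsPointedTriangulation C v P)
    (m : ℕ → ℕ) (σ : (k : ℕ) → Affine.Simplex ℝ (EuclideanSpace ℝ (Fin (m k))) k)
    (w : (k : ℕ) → Set (EuclideanSpace ℝ (Fin (m k))) → EuclideanSpace ℝ (Fin (m k)))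
    (hw : ∀ k, Polytope.IsApexChoice (w k) (Polytope.simplexSet (σ k)))
    (n : ℕ) (hn : n ≠ 1) :
    Polytope.polytopeNumber v P n =
      ∑ k ∈ Finset.range (Polytope.dim P + 1),
        (Polytope.numSimplices C k : ℤ) *
          Polytope.polytopeNumber (w k) (Polytope.simplexSet (σ k)) (n - (k + 1)) :=
  mainTheorem10_general P hP C v hC.isConicalTriangulation σ w (fun k => (hw k).mem_vert) n hn
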